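/- Let $\mathbb D=\{z\in\mathbb C:|z|<1\}$ and let $m$ be normalized Lebesgue measure on $\partial\mathbb D$. An inner function is an analytic map $g:\mathbb D\to\mathbb D$ whose radial limit $g(\xi)=\lim_{r\to1^-}g(r\xi)$ exists and has modulus one at $m$-almost every $\xi\in\partial\mathbb D$. Let $f$ be an inner function with $f(0)=0$ which is not a rotation (that is, not of the form $z\mapsto cz$ with $|c|=1$), and let $f^n$ be its $n$-th iterate, $n\ge1$. Then each $f^n$ is again an inner function, so that $f^n(\xi)=\lim_{r\to1^-}f^n(r\xi)$ is defined for almost every $\xi\in\partial\mathbb D$, and there is a constant $C=C(f)>0$ such that for every positive integer $N$, all complex numbers $a_1,\dots,a_N$ and every $z\in\mathbb D$, the integrand below is $m$-integrable and $$\int_{\partial\mathbb D}\Bigl|\sum_{n=1}^{N}a_n\bigl(f^n(\xi)-f^n(z)\bigr)\Bigr|^2P(z,\xi)\,dm(\xi)\;\le\;C\sum_{n=1}^{N}|a_n|^2\bigl(1-|f^n(z)|^2\bigr),$$ where $P(z,\xi)=(1-|z|^2)\,|\xi-z|^{-2}$ is the Poisson kernel. -/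

import Mathlib

open Filter Topology MeasureTheory Set

/-- `g` has radial limit `η` at the point `ξ` of the unit circle: `g (r ξ) → η` as `r → 1⁻`. -/
def HasRadialLimit (g : ℂ → ℂ) (ξ η : ℂ) : Prop :=
  Tendsto (fun r : ℝ => g ((r : ℂ) * ξ)) (𝓝[<] (1 : ℝ)) (𝓝 η)

/-- The boundary function `ξ ↦ g(ξ) = lim_{r → 1⁻} g (r ξ)` of a function `g` on the unit disc.
It is meaningful at those `ξ` where the radial limit exists. -/
noncomputable def radialLimit (g : ℂ → ℂ) (ξ : ℂ) : ℂ :=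
  limUnder (𝓝[<] (1 : ℝ)) (fun r : ℝ => g ((r : ℂ) * ξ))

/-- Inner functions: analytic maps of the open unit disc into itself whose radial limits exist
and have modulus one at almost every point of the unit circle. Only the values of `g` in the open
unit disc matter. The circle is parametrised by `θ ↦ circleMap 0 1 θ = exp (i θ)`. -/
structure IsInnerFunction (g : ℂ → ℂ) : Prop where
  differentiableOn : DifferentiableOn ℂ g (Metric.ball 0 1)
  mapsTo : MapsTo g (Metric.ball 0 1) (Metric.ball 0 1)
  ae_radialLimit : ∀ᵐ θ : ℝ, ∃ η : ℂ, ‖η‖ = 1 ∧ HasRadialLimit g (circleMap 0 1 θ) η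

/-- `g` is, on the open unit disc, a rotation `z ↦ c z` with `|c| = 1`. -/
def IsDiscRotation (g : ℂ → ℂ) : Prop :=
  ∃ c : ℂ, ‖c‖ = 1 ∧ EqOn g (fun z => c * z) (Metric.ball 0 1)

/-- The integrand `ξ ↦ |∑_{n=1}^N a_n (f^n(ξ) - f^n(z))|² P(z, ξ)`, where `f^n = f^[n]` is the
`n`-th iterate of `f` on the disc, `f^n(ξ)` is its radial limit at `ξ`, and
`P(z, ξ) = (1 - |z|²) / |ξ - z|²` for `|ξ| = 1` is the Poisson kernel of the unit disc. -/
noncomputable def oscillationIntegrand (f : ℂ → ℂ) (N : ℕ) (a : ℕ → ℂ) (z ξ : ℂ) : ℝ :=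
  ‖∑ n ∈ Finset.Icc 1 N, a n * (radialLimit (f^[n]) ξ - f^[n] z)‖ ^ 2 * poissonKernel 0 z ξ

/-!
Let `ω_z` be harmonic measure seen from `z` and write `F*` for the boundary function of a bounded
analytic `F`. It exists almost everywhere: a Lipschitz primitive of `F` is differentiable along the
circle almost everywhere, and its derivative `F` has a radial limit wherever it is. Hence
`∫ F* dω_z = F z`.

For `g` inner, `|g*| = 1` turns `F = F 0 + w (F - F 0) / w` into a recursion giving
`∫ (F ∘ g)* conj(g*)^k dω_z = ∫ F* conj(ξ)^k dω_{g z}`, so that the pairing of `(F ∘ g)*` with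
`f_r(g*)`, `f_r(w) = f (r w)`, is transported from `ω_z` to `ω_{g z}`. With `F = f` inner and
`r → 1` this forces `∫ |(f ∘ g)*| dω_z ≥ 1`, and `f ∘ g` is inner.

If `f 0 = 0`, then `f^[j + k] = f^[k] · (q_j ∘ f^[k])` with `q_j(w) = f^[j] w / w`. As
`|f^[k]*| = 1`, the covariance under `ω_z` of the boundary functions of `f^[j + k]` and `f^[k]` is
`q_j(w) (1 - |w|²)` with `w = f^[k] z`. For `f` not a rotation, `f w / w` maps the disc into itself,
and the Schwarz–Pick inequality bounds this covariance by
`c^j √(1 - |f^[j + k] z|²) √(1 - |f^[k] z|²)` with `c < 1`. The Schur test then bounds the second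
moment of the linear combination.
-/

local notation "𝔻" => Metric.ball (0 : ℂ) 1

/-- The derivative of `ζ ↦ poissonKernel 0 r ζ` in the direction tangent to the unit circle, up to
the constant factor `I / r`; its circle average against `G` is `deriv G r`. -/
noncomputable def tangentialPoissonKernel (r : ℝ) (ζ : ℂ) : ℂ :=
  ζ / (ζ - r) ^ 2 - ζ / (1 - r * ζ) ^ 2

section Kernels

variable {r : ℝ} {w ζ : ℂ}

lemma one_sub_norm_sq_pos (hw : w ∈ 𝔻) : 0 < 1 - ‖w‖ ^ 2 := by
  nlinarith [norm_nonneg w, mem_ball_zero_iff.1 hw]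

lemma ofReal_mem_unitBall (hr : r ∈ Ico 0 1) : (r : ℂ) ∈ 𝔻 := by
  simpa [abs_of_nonneg hr.1] using hr.2

lemma ofReal_mul_mem_unitBall (hr : r ∈ Ico 0 1) (hζ : ‖ζ‖ ≤ 1) : (r : ℂ) * ζ ∈ 𝔻 := by
  rw [mem_ball_zero_iff, norm_mul, Complex.norm_of_nonneg hr.1]
  exact mul_lt_one_of_nonneg_of_lt_one_left hr.1 hr.2 hζ

lemma one_sub_ofReal_mul_ne_zero (hr : r ∈ Ico 0 1) (hζ : ‖ζ‖ ≤ 1) : 1 - r * ζ ≠ 0 := by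
  intro h
  simpa [← sub_eq_zero.1 h] using ofReal_mul_mem_unitBall hr hζ

lemma sub_ne_zero_of_mem_unitBall (hw : w ∈ 𝔻) (hζ : ‖ζ‖ = 1) : ζ - w ≠ 0 := by
  rintro h
  rw [sub_eq_zero.1 h] at hζ
  exact (mem_ball_zero_iff.1 hw).ne hζ

lemma norm_one_sub_ofReal_mul (hζ : ‖ζ‖ = 1) : ‖1 - r * ζ‖ = ‖ζ - r‖ := by
  have h : 1 - r * ζ = ζ * starRingEnd ℂ (ζ - r) := by
    rw [map_sub, mul_sub, Complex.mul_conj', hζ, Complex.conj_ofReal]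
    push_cast
    ring
  rw [h, norm_mul, hζ, RCLike.norm_conj, one_mul]

lemma poissonKernel_of_norm_eq_one (hζ : ‖ζ‖ = 1) :
    poissonKernel 0 w ζ = (1 - ‖w‖ ^ 2) / ‖ζ - w‖ ^ 2 := by
  simp only [poissonKernel_def, sub_zero, hζ, one_pow]

lemma poissonKernel_nonneg (hw : w ∈ 𝔻) (hζ : ‖ζ‖ = 1) : 0 ≤ poissonKernel 0 w ζ := by
  rw [poissonKernel_of_norm_eq_one hζ]
  exact div_nonneg (one_sub_norm_sq_pos hw).le (sq_nonneg _)

lemma continuousOn_poissonKernel (hw : w ∈ 𝔻) :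
    ContinuousOn (poissonKernel 0 w) (Metric.sphere 0 1) := by
  rw [poissonKernel_eq_re_herglotzRieszKernel]
  simpa using Complex.continuous_re.comp_continuousOn
    (continuousOn_herglotzRieszKernel_sphere (R := 1) hw)

lemma circleAverage_poissonKernel (hw : w ∈ 𝔻) :
    Real.circleAverage (poissonKernel 0 w) 0 1 = 1 := by
  have hone : Real.circleAverage (fun ζ => (poissonKernel 0 w ζ : ℂ)) 0 1 = 1 := by
    simpa [Pi.smul_def'] using
      (diffContOnCl_const (c := (1 : ℂ))).circleAverage_poissonKernel_smul hw
  rw [Real.circleAverage_def] at hone ⊢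
  rw [intervalIntegral.integral_ofReal, Complex.real_smul] at hone
  exact_mod_cast hone

lemma continuousOn_tangentialPoissonKernel (hr : r ∈ Ico 0 1) :
    ContinuousOn (tangentialPoissonKernel r) (Metric.sphere 0 1) := by
  have h₁ : ∀ ζ ∈ Metric.sphere (0 : ℂ) 1, (ζ - r) ^ 2 ≠ 0 := fun ζ hζ =>
    pow_ne_zero _ (sub_ne_zero_of_mem_unitBall (ofReal_mem_unitBall hr)
      (mem_sphere_zero_iff_norm.1 hζ))
  have h₂ : ∀ ζ ∈ Metric.sphere (0 : ℂ) 1, (1 - r * ζ) ^ 2 ≠ 0 := fun ζ hζ =>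
    pow_ne_zero _ (one_sub_ofReal_mul_ne_zero hr (mem_sphere_zero_iff_norm.1 hζ).le)
  exact (continuousOn_id.div (by fun_prop) h₁).sub (continuousOn_id.div (by fun_prop) h₂)

lemma norm_tangentialPoissonKernel_le (hr : r ∈ Ico 0 1) (hζ : ‖ζ‖ = 1) :
    ‖tangentialPoissonKernel r ζ‖ ≤ 2 * ‖ζ - 1‖ * poissonKernel 0 r ζ / ‖ζ - r‖ ^ 2 := by
  have h₁ := sub_ne_zero_of_mem_unitBall (ofReal_mem_unitBall hr) hζ
  have h₂ := one_sub_ofReal_mul_ne_zero hr hζ.le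
  have hfactor : tangentialPoissonKernel r ζ =
      ζ * (1 - ζ) * (1 + ζ) * ((1 - r ^ 2 : ℝ) : ℂ) / ((ζ - r) ^ 2 * (1 - r * ζ) ^ 2) := by
    rw [tangentialPoissonKernel, div_sub_div _ _ (pow_ne_zero 2 h₁) (pow_ne_zero 2 h₂)]
    push_cast
    ring
  have hadd : ‖1 + ζ‖ ≤ 2 := (norm_add_le 1 ζ).trans (by rw [norm_one, hζ]; norm_num)
  have hr2 : 0 ≤ 1 - r ^ 2 := by nlinarith [hr.1, hr.2]
  rw [hfactor, poissonKernel_of_norm_eq_one hζ, norm_div, norm_mul, norm_mul, norm_mul, norm_mul,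
    norm_pow, norm_pow, norm_one_sub_ofReal_mul hζ, hζ, one_mul, norm_sub_rev 1 ζ,
    Complex.norm_of_nonneg hr2, Complex.norm_of_nonneg hr.1]
  calc ‖ζ - 1‖ * ‖1 + ζ‖ * (1 - r ^ 2) / (‖ζ - r‖ ^ 2 * ‖ζ - r‖ ^ 2)
      ≤ ‖ζ - 1‖ * 2 * (1 - r ^ 2) / (‖ζ - r‖ ^ 2 * ‖ζ - r‖ ^ 2) := by gcongr
    _ = 2 * ‖ζ - 1‖ * ((1 - r ^ 2) / ‖ζ - r‖ ^ 2) / ‖ζ - r‖ ^ 2 := by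
        rw [mul_div_assoc', div_div]; ring

lemma norm_sub_one_le_two_mul_norm_sub (hr : r ∈ Ico 0 1) (hζ : ‖ζ‖ = 1) :
    ‖ζ - 1‖ ≤ 2 * ‖ζ - r‖ := by
  have h₁ : 1 - r ≤ ‖ζ - r‖ := by
    simpa [hζ, abs_of_nonneg hr.1] using norm_sub_norm_le ζ (r : ℂ)
  have h₂ : ‖(r : ℂ) - 1‖ = 1 - r := by
    rw [norm_sub_rev, ← Complex.ofReal_one, ← Complex.ofReal_sub,
      Complex.norm_of_nonneg (sub_nonneg.2 hr.2.le)]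
  linarith [norm_sub_le_norm_sub_add_norm_sub ζ r 1]

end Kernels

section RadialDerivative

variable {F G : ℂ → ℂ} {r : ℝ} {w ξ η : ℂ}

lemma continuousOn_sphere_of_diffContOnCl_ball (hG : DiffContOnCl ℂ G 𝔻) :
    ContinuousOn G (Metric.sphere 0 1) :=
  hG.continuousOn_ball.mono Metric.sphere_subset_closedBall

lemma circleAverage_herglotzRieszKernel_smul (hG : DiffContOnCl ℂ G 𝔻) (hw : w ∈ 𝔻) :
    Real.circleAverage (fun ζ => herglotzRieszKernel 0 w ζ • G ζ) 0 1 = 2 * G w - G 0 := by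
  have hG₁ : DiffContOnCl ℂ G (Metric.ball 0 |1|) := by rwa [abs_one]
  have hcont := continuousOn_sphere_of_diffContOnCl_ball hG
  have hne : ∀ ζ ∈ Metric.sphere (0 : ℂ) 1, ζ - w ≠ 0 := fun ζ hζ =>
    sub_ne_zero_of_mem_unitBall hw (mem_sphere_zero_iff_norm.1 hζ)
  have hinteg : CircleIntegrable (fun ζ => ((ζ - 0) / (ζ - w)) • G ζ) 0 1 :=
    ContinuousOn.circleIntegrable zero_le_one
      ((ContinuousOn.div (by fun_prop) (by fun_prop) hne).smul hcont)
  calc Real.circleAverage (fun ζ => herglotzRieszKernel 0 w ζ • G ζ) 0 1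
      = Real.circleAverage ((2 : ℂ) • (fun ζ => ((ζ - 0) / (ζ - w)) • G ζ) - G) 0 1 := by
        refine Real.circleAverage_congr_sphere fun ζ hζ => ?_
        have := hne ζ (by simpa using hζ)
        simp only [herglotzRieszKernel_def, sub_zero, Pi.sub_apply, Pi.smul_apply, smul_eq_mul]
        field_simp
        ring
    _ = 2 * G w - G 0 := by
        rw [Real.circleAverage_sub hinteg.const_smul (hcont.circleIntegrable zero_le_one),
          Real.circleAverage_smul, hG₁.circleAverage_smul_div (by rwa [abs_one]),
          hG₁.circleAverage, smul_eq_mul]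

lemma two_mul_deriv_eq_circleAverage (hG : DiffContOnCl ℂ G 𝔻) (hw : w ∈ 𝔻) :
    2 * deriv G w = Real.circleAverage (fun ζ => (2 * ζ / (ζ - w) ^ 2) • G ζ) 0 1 := by
  have hderiv := hasDerivAt_circleAverage_herglotzRieszKernel_smul
    ((continuousOn_sphere_of_diffContOnCl_ball hG).circleIntegrable zero_le_one) hw
  have heq : (fun v => Real.circleAverage (fun ζ => herglotzRieszKernel 0 v ζ • G ζ) 0 1)
      =ᶠ[𝓝 w] fun v => 2 * G v - G 0 :=
    eventually_of_mem (Metric.isOpen_ball.mem_nhds hw) fun v =>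
      circleAverage_herglotzRieszKernel_smul hG
  have hGw : HasDerivAt G (deriv G w) w := (hG.differentiableAt Metric.isOpen_ball hw).hasDerivAt
  exact ((hGw.const_mul 2).sub_const (G 0)).unique (hderiv.congr_of_eventuallyEq heq.symm)

lemma deriv_eq_circleAverage_tangentialPoissonKernel (hG : DiffContOnCl ℂ G 𝔻)
    (hr : r ∈ Ico 0 1) :
    deriv G r = Real.circleAverage (fun ζ => tangentialPoissonKernel r ζ * G ζ) 0 1 := by
  set k : ℂ → ℂ := fun ζ => ζ / (1 - r * ζ) ^ 2 * G ζ with hk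
  have hkd : DiffContOnCl ℂ k 𝔻 := by
    refine DiffContOnCl.smul (𝕜' := ℂ) (DifferentiableOn.diffContOnCl ?_) hG
    rw [closure_ball _ one_ne_zero]
    exact differentiableOn_id.div (by fun_prop) fun ζ hζ =>
      pow_ne_zero _ (one_sub_ofReal_mul_ne_zero hr (mem_closedBall_zero_iff.1 hζ))
  have hk0 : Real.circleAverage k 0 1 = 0 := by
    rw [DiffContOnCl.circleAverage (by rwa [abs_one])]
    simp [hk]
  have hKG := ((continuousOn_tangentialPoissonKernel hr).mul
    (continuousOn_sphere_of_diffContOnCl_ball hG)).circleIntegrable zero_le_one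
  have hki := (continuousOn_sphere_of_diffContOnCl_ball hkd).circleIntegrable zero_le_one
  refine mul_left_cancel₀ (two_ne_zero (α := ℂ)) ?_
  calc 2 * deriv G r = Real.circleAverage (fun ζ => (2 * ζ / (ζ - r) ^ 2) • G ζ) 0 1 :=
        two_mul_deriv_eq_circleAverage hG (ofReal_mem_unitBall hr)
    _ = Real.circleAverage ((2 : ℂ) • (tangentialPoissonKernel r * G + k)) 0 1 := by
        congr 1
        ext ζ
        simp only [tangentialPoissonKernel, hk, Pi.smul_apply, Pi.add_apply, Pi.mul_apply,
          smul_eq_mul]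
        ring
    _ = 2 * Real.circleAverage (fun ζ => tangentialPoissonKernel r ζ * G ζ) 0 1 := by
        rw [Real.circleAverage_smul, Real.circleAverage_add hKG hki, hk0, add_zero, smul_eq_mul]
        rfl

lemma norm_circleAverage_le (G : ℂ → ℂ) :
    ‖Real.circleAverage G 0 1‖ ≤ Real.circleAverage (fun ζ => ‖G ζ‖) 0 1 := by
  rw [Real.circleAverage_def, Real.circleAverage_def, norm_smul,
    Real.norm_of_nonneg (by positivity), smul_eq_mul]
  gcongr
  exact intervalIntegral.norm_integral_le_integral_norm (by positivity)

lemma norm_tangentialPoissonKernel_mul_le {ε M : ℝ} (hε : 0 ≤ ε) (hM : 0 ≤ M) {ζ g : ℂ}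
    (hr : r ∈ Ico 0 1) (hζ : ‖ζ‖ = 1) (hg : ‖g‖ ≤ ε * ‖ζ - 1‖ + M * ‖ζ - 1‖ ^ 3) :
    ‖tangentialPoissonKernel r ζ * g‖ ≤ 8 * ε * poissonKernel 0 r ζ + 32 * M * (1 - r ^ 2) := by
  have hP := poissonKernel_nonneg (ofReal_mem_unitBall hr) hζ
  have hρ : 0 < ‖ζ - r‖ :=
    norm_pos_iff.2 (sub_ne_zero_of_mem_unitBall (ofReal_mem_unitBall hr) hζ)
  have : 0 ≤ 1 - r ^ 2 := by nlinarith [hr.1, hr.2]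
  rw [norm_mul]
  calc ‖tangentialPoissonKernel r ζ‖ * ‖g‖
      ≤ 2 * ‖ζ - 1‖ * poissonKernel 0 r ζ / ‖ζ - r‖ ^ 2 *
          (ε * ‖ζ - 1‖ + M * ‖ζ - 1‖ ^ 3) := by
        gcongr
        exact norm_tangentialPoissonKernel_le hr hζ
    _ = 2 * poissonKernel 0 r ζ / ‖ζ - r‖ ^ 2 * (ε * ‖ζ - 1‖ ^ 2 + M * ‖ζ - 1‖ ^ 4) := by ring
    _ ≤ 2 * poissonKernel 0 r ζ / ‖ζ - r‖ ^ 2 *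
          (ε * (2 * ‖ζ - r‖) ^ 2 + M * (2 * ‖ζ - r‖) ^ 4) := by
        gcongr <;> exact norm_sub_one_le_two_mul_norm_sub hr hζ
    _ = 8 * ε * poissonKernel 0 r ζ + 32 * M * (1 - r ^ 2) := by
        rw [poissonKernel_of_norm_eq_one hζ, Complex.norm_of_nonneg hr.1]
        field_simp
        ring

lemma norm_deriv_le_of_norm_le {ε M : ℝ} (hε : 0 ≤ ε) (hM : 0 ≤ M) (hr : r ∈ Ico 0 1)
    (hG : DiffContOnCl ℂ G 𝔻)
    (hbound : ∀ ζ ∈ Metric.sphere (0 : ℂ) 1, ‖G ζ‖ ≤ ε * ‖ζ - 1‖ + M * ‖ζ - 1‖ ^ 3) :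
    ‖deriv G r‖ ≤ 8 * ε + 32 * M * (1 - r ^ 2) := by
  have hrb := ofReal_mem_unitBall hr
  have hP : CircleIntegrable (poissonKernel 0 r) 0 1 :=
    (continuousOn_poissonKernel hrb).circleIntegrable zero_le_one
  have hKG := (continuousOn_tangentialPoissonKernel hr).mul
    (continuousOn_sphere_of_diffContOnCl_ball hG)
  have hmajor : CircleIntegrable
      ((8 * ε) • poissonKernel 0 r + fun _ => 32 * M * (1 - r ^ 2)) 0 1 :=
    hP.const_smul.add (circleIntegrable_const _ _ _)
  rw [deriv_eq_circleAverage_tangentialPoissonKernel hG hr]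
  calc ‖Real.circleAverage (fun ζ => tangentialPoissonKernel r ζ * G ζ) 0 1‖
      ≤ Real.circleAverage (fun ζ => ‖tangentialPoissonKernel r ζ * G ζ‖) 0 1 :=
        norm_circleAverage_le _
    _ ≤ Real.circleAverage ((8 * ε) • poissonKernel 0 r + fun _ => 32 * M * (1 - r ^ 2)) 0 1 := by
        refine Real.circleAverage_mono (hKG.norm.circleIntegrable zero_le_one) hmajor fun ζ hζ => ?_
        rw [abs_one] at hζ
        exact norm_tangentialPoissonKernel_mul_le hε hM hr (mem_sphere_zero_iff_norm.1 hζ)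
          (hbound ζ hζ)
    _ = 8 * ε + 32 * M * (1 - r ^ 2) := by
        rw [Real.circleAverage_add hP.const_smul (circleIntegrable_const _ _ _),
          Real.circleAverage_smul, circleAverage_poissonKernel hrb, Real.circleAverage_const,
          smul_eq_mul, mul_one]

lemma tendsto_deriv_of_isLittleO (hG : DiffContOnCl ℂ G 𝔻)
    (ho : G =o[𝓝[Metric.sphere 0 1] 1] fun ζ => ζ - 1) :
    Tendsto (fun r : ℝ => deriv G r) (𝓝[<] 1) (𝓝 0) := by
  obtain ⟨B, hB⟩ := (isCompact_sphere (0 : ℂ) 1).exists_bound_of_continuousOn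
    (continuousOn_sphere_of_diffContOnCl_ball hG)
  have hB0 : 0 ≤ B := (norm_nonneg _).trans (hB 1 (by simp))
  rw [Metric.tendsto_nhds]
  intro ε hε
  obtain ⟨δ, hδ, hnear⟩ := Metric.mem_nhdsWithin_iff.1 (ho.bound (show 0 < ε / 16 by positivity))
  have hbound : ∀ ζ ∈ Metric.sphere (0 : ℂ) 1,
      ‖G ζ‖ ≤ ε / 16 * ‖ζ - 1‖ + B / δ ^ 3 * ‖ζ - 1‖ ^ 3 := by
    intro ζ hζ
    rcases lt_or_ge ‖ζ - 1‖ δ with h | h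
    · exact (hnear ⟨by simpa [dist_eq_norm] using h, hζ⟩ : ‖G ζ‖ ≤ _).trans
        (le_add_of_nonneg_right (by positivity))
    · calc ‖G ζ‖ ≤ B / δ ^ 3 * δ ^ 3 := by
            rw [div_mul_cancel₀ _ (by positivity)]; exact hB ζ hζ
        _ ≤ B / δ ^ 3 * ‖ζ - 1‖ ^ 3 := by gcongr
        _ ≤ _ := le_add_of_nonneg_left (by positivity)
  have hlim : Tendsto (fun r : ℝ => 8 * (ε / 16) + 32 * (B / δ ^ 3) * (1 - r ^ 2)) (𝓝[<] 1)
      (𝓝 (8 * (ε / 16) + 32 * (B / δ ^ 3) * (1 - 1 ^ 2))) :=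
    (Continuous.tendsto (by fun_prop) 1).mono_left nhdsWithin_le_nhds
  filter_upwards [hlim.eventually_lt_const (by linarith : _ < ε),
    Ico_mem_nhdsLT (zero_lt_one' ℝ)] with r hr hr01
  rw [dist_zero_right]
  exact (norm_deriv_le_of_norm_le (by positivity) (by positivity) hr01 hG hbound).trans_lt hr

lemma hasRadialLimit_deriv_of_hasDerivWithinAt_sphere (hF : DiffContOnCl ℂ F 𝔻)
    (hξ : ‖ξ‖ = 1) (hη : HasDerivWithinAt F η (Metric.sphere 0 1) ξ) :
    HasRadialLimit (deriv F) ξ η := by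
  have hξ0 : ξ ≠ 0 := norm_pos_iff.1 (hξ ▸ one_pos)
  set G : ℂ → ℂ := fun ζ => F (ξ * ζ) - F ξ - ξ * η * (ζ - 1) with hG
  have hmaps : MapsTo (ξ * ·) 𝔻 𝔻 := fun z hz => by simpa [hξ] using hz
  have hGd : DiffContOnCl ℂ G 𝔻 :=
    ((hF.comp (Differentiable.diffContOnCl (by fun_prop)) hmaps).sub diffContOnCl_const).sub
      (Differentiable.diffContOnCl (by fun_prop))
  have hGo : G =o[𝓝[Metric.sphere 0 1] 1] fun ζ => ζ - 1 := by
    have hrot : HasDerivWithinAt (fun ζ => F (ξ * ζ)) (η * (ξ * 1)) (Metric.sphere 0 1) 1 :=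
      HasDerivWithinAt.comp (1 : ℂ) (by simpa using hη)
        ((hasDerivWithinAt_id _ _).const_mul ξ) fun ζ hζ => by simpa [hξ] using hζ
    refine hrot.isLittleO.congr_left fun ζ => ?_
    simp only [hG, mul_one, smul_eq_mul]
    ring
  have hlim := ((tendsto_deriv_of_isLittleO hGd hGo).add_const (ξ * η)).const_mul ξ⁻¹
  rw [zero_add, inv_mul_cancel_left₀ hξ0] at hlim
  refine hlim.congr' ?_
  filter_upwards [Ico_mem_nhdsLT (zero_lt_one' ℝ)] with r hr
  have hFr : HasDerivAt F (deriv F (ξ * r)) (ξ * r) :=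
    (hF.differentiableAt Metric.isOpen_ball (hmaps (ofReal_mem_unitBall hr))).hasDerivAt
  have hGr : HasDerivAt G (deriv F (ξ * r) * (ξ * 1) - ξ * η * 1) r :=
    ((hFr.comp (r : ℂ) ((hasDerivAt_id _).const_mul ξ)).sub_const _).sub
      (((hasDerivAt_id _).sub_const 1).const_mul _)
  rw [hGr.deriv, mul_comm (r : ℂ) ξ]
  field_simp
  ring

end RadialDerivative

section Fatou

lemma hasDerivWithinAt_comp_real {E : Type*} [NormedAddCommGroup E] [NormedSpace ℂ E]
    {φ : ℝ → E} {ψ : ℂ → ℝ} {φ' : E} {ψ' ξ : ℂ} {s : Set ℂ}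
    (hφ : HasDerivAt φ φ' (ψ ξ)) (hψ : HasDerivWithinAt (fun ζ => (ψ ζ : ℂ)) ψ' s ξ) :
    HasDerivWithinAt (fun ζ => φ (ψ ζ)) (ψ' • φ') s ξ := by
  have hlim : Tendsto ψ (𝓝[s] ξ) (𝓝 (ψ ξ)) :=
    (Complex.continuous_re.tendsto _).comp hψ.continuousWithinAt.tendsto
  have hbigO : (fun ζ => ψ ζ - ψ ξ) =O[𝓝[s] ξ] fun ζ => ζ - ξ :=
    .of_norm_left <| hψ.hasFDerivWithinAt.isBigO_sub.norm_left.congr_left fun ζ => by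
      rw [← Complex.ofReal_sub, Complex.norm_real]
  refine hasDerivWithinAt_iff_isLittleO.2 <|
    (((hφ.isLittleO.comp_tendsto hlim).trans_isBigO hbigO).add
      (hψ.smul_const φ').isLittleO).congr_left fun ζ => ?_
  simp only [Function.comp_apply, ← sub_smul, Complex.coe_smul]
  abel

variable {F g : ℂ → ℂ} {θ : ℝ}

lemma exists_hasDerivWithinAt_sphere
    (hθ : DifferentiableAt ℝ (fun t => F (circleMap 0 1 t)) θ) :
    ∃ η, HasDerivWithinAt F η (Metric.sphere 0 1) (circleMap 0 1 θ) := by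
  set ξ := circleMap 0 1 θ with hξ
  have hξ1 : ‖ξ‖ = 1 := by simp [hξ]
  have hξ0 : ξ ≠ 0 := circleMap_ne_center one_ne_zero
  have hlog : HasDerivAt (fun ζ => θ + -Complex.I * Complex.log (ζ / ξ))
      (-Complex.I * (1 / ξ / (ξ / ξ))) ξ :=
    ((((hasDerivAt_id ξ).div_const ξ).clog (by simp [hξ0])).const_mul _).const_add _
  have harg : ∀ ζ ∈ Metric.sphere (0 : ℂ) 1,
      ((θ + Complex.arg (ζ / ξ) : ℝ) : ℂ) = θ + -Complex.I * Complex.log (ζ / ξ) := by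
    intro ζ hζ
    rw [Complex.log, norm_div, mem_sphere_zero_iff_norm.1 hζ, hξ1, div_one, Real.log_one]
    push_cast
    linear_combination (Complex.arg (ζ / ξ) : ℂ) * Complex.I_sq
  have hcircle : ∀ ζ ∈ Metric.sphere (0 : ℂ) 1,
      F ζ = F (circleMap 0 1 (θ + Complex.arg (ζ / ξ))) := by
    intro ζ hζ
    have hexp := Complex.norm_mul_exp_arg_mul_I (ζ / ξ)
    rw [norm_div, mem_sphere_zero_iff_norm.1 hζ, hξ1, div_one, Complex.ofReal_one, one_mul] at hexp
    rw [circleMap_zero, Complex.ofReal_one, one_mul] at hξ ⊢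
    rw [Complex.ofReal_add, add_mul, Complex.exp_add, hexp, ← hξ, mul_div_cancel₀ ζ hξ0]
  have hξs : ξ ∈ Metric.sphere (0 : ℂ) 1 := mem_sphere_zero_iff_norm.2 hξ1
  have hθ' : HasDerivAt (fun t => F (circleMap 0 1 t)) (deriv (fun t => F (circleMap 0 1 t)) θ)
      (θ + Complex.arg (ξ / ξ)) := by
    simpa [hξ0] using hθ.hasDerivAt
  exact ⟨_, (hasDerivWithinAt_comp_real hθ'
    (hlog.hasDerivWithinAt.congr harg (harg ξ hξs))).congr hcircle (hcircle ξ hξs)⟩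

/-- Bounded analytic functions on the open unit disc. -/
structure IsBoundedAnalytic (g : ℂ → ℂ) : Prop where
  differentiableOn : DifferentiableOn ℂ g 𝔻
  bounded : ∃ M, ∀ z ∈ 𝔻, ‖g z‖ ≤ M

lemma IsBoundedAnalytic.exists_lipschitzWith_primitive (hg : IsBoundedAnalytic g) :
    ∃ (F : ℂ → ℂ) (K : NNReal), LipschitzWith K F ∧ ∀ z ∈ 𝔻, HasDerivAt F (g z) z := by
  obtain ⟨F₀, hF₀⟩ := hg.differentiableOn.isExactOn_ball
  obtain ⟨M, hM⟩ := hg.bounded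
  have hlip : LipschitzOnWith M.toNNReal F₀ 𝔻 :=
    (convex_ball _ _).lipschitzOnWith_of_nnnorm_hasDerivWithin_le
      (fun z hz => (hF₀ z hz).hasDerivWithinAt)
      fun z hz => NNReal.coe_le_coe.1 ((hM z hz).trans (Real.le_coe_toNNReal M))
  obtain ⟨F, hF, hEq⟩ := hlip.extend_finite_dimension
  exact ⟨F, _, hF, fun z hz => (hF₀ z hz).congr_of_eventuallyEq
    (eventually_of_mem (Metric.isOpen_ball.mem_nhds hz) fun y hy => (hEq hy).symm)⟩

/-- **Fatou theorem** -/
theorem IsBoundedAnalytic.ae_exists_hasRadialLimit (hg : IsBoundedAnalytic g) :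
    ∀ᵐ θ : ℝ, ∃ η, HasRadialLimit g (circleMap 0 1 θ) η := by
  obtain ⟨F, K, hF, hFg⟩ := hg.exists_lipschitzWith_primitive
  have hFd : DiffContOnCl ℂ F 𝔻 :=
    ⟨fun z hz => (hFg z hz).differentiableAt.differentiableWithinAt, hF.continuous.continuousOn⟩
  filter_upwards [(hF.comp (lipschitzWith_circleMap 0 1)).ae_differentiableAt_real] with θ hθ
  obtain ⟨η, hη⟩ := exists_hasDerivWithinAt_sphere hθ
  refine ⟨η, (hasRadialLimit_deriv_of_hasDerivWithinAt_sphere hFd (by simp) hη).congr' ?_⟩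
  filter_upwards [Ico_mem_nhdsLT (zero_lt_one' ℝ)] with r hr
  exact (hFg _ (ofReal_mul_mem_unitBall hr (by simp))).deriv

end Fatou

section HarmonicMeasure

/-- Harmonic measure of the unit disc seen from `z`, transported to the angular interval
`(0, 2π]`. -/
noncomputable def discHarmonicMeasure (z : ℂ) : Measure ℝ :=
  (volume.restrict (Ioc 0 (2 * Real.pi))).withDensity fun θ =>
    ENNReal.ofReal ((2 * Real.pi)⁻¹ * poissonKernel 0 z (circleMap 0 1 θ))

variable {E : Type*} [NormedAddCommGroup E] [NormedSpace ℝ E] {z : ℂ}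

lemma measurable_poissonKernel_circleMap (z : ℂ) :
    Measurable fun θ : ℝ => poissonKernel 0 z (circleMap 0 1 θ) := by
  simp only [poissonKernel_def]
  exact Measurable.div (by fun_prop) (by fun_prop)

lemma discHarmonicMeasure_absolutelyContinuous (z : ℂ) : discHarmonicMeasure z ≪ volume :=
  (withDensity_absolutelyContinuous _ _).trans Measure.absolutelyContinuous_restrict

lemma toReal_discHarmonicMeasure_density (hz : z ∈ 𝔻) (θ : ℝ) :
    (ENNReal.ofReal ((2 * Real.pi)⁻¹ * poissonKernel 0 z (circleMap 0 1 θ))).toReal =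
      (2 * Real.pi)⁻¹ * poissonKernel 0 z (circleMap 0 1 θ) :=
  ENNReal.toReal_ofReal (mul_nonneg (by positivity) (poissonKernel_nonneg hz (by simp)))

lemma integral_discHarmonicMeasure (hz : z ∈ 𝔻) (G : ℂ → E) :
    ∫ θ, G (circleMap 0 1 θ) ∂discHarmonicMeasure z =
      Real.circleAverage (fun ζ => poissonKernel 0 z ζ • G ζ) 0 1 := by
  rw [discHarmonicMeasure, integral_withDensity_eq_integral_toReal_smul
    ((measurable_poissonKernel_circleMap z).const_mul _).ennreal_ofReal (by simp),
    Real.circleAverage_def, intervalIntegral.integral_of_le (by positivity), ← integral_smul]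
  simp only [toReal_discHarmonicMeasure_density hz, mul_smul]

lemma integrable_discHarmonicMeasure_iff (hz : z ∈ 𝔻) (G : ℂ → E) :
    Integrable (fun θ => G (circleMap 0 1 θ)) (discHarmonicMeasure z) ↔
      CircleIntegrable (fun ζ => poissonKernel 0 z ζ • G ζ) 0 1 := by
  rw [discHarmonicMeasure, integrable_withDensity_iff_integrable_smul'
    ((measurable_poissonKernel_circleMap z).const_mul _).ennreal_ofReal (by simp),
    CircleIntegrable, intervalIntegrable_iff_integrableOn_Ioc_of_le (by positivity), IntegrableOn]
  simp only [toReal_discHarmonicMeasure_density hz, mul_smul]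
  exact integrable_fun_smul_iff (by positivity) _

lemma isProbabilityMeasure_discHarmonicMeasure (hz : z ∈ 𝔻) :
    IsProbabilityMeasure (discHarmonicMeasure z) := by
  have hone := integral_discHarmonicMeasure hz fun _ => (1 : ℝ)
  simp only [smul_eq_mul, mul_one, integral_const] at hone
  exact ⟨(ENNReal.toReal_eq_one_iff _).1 (hone.trans (circleAverage_poissonKernel hz))⟩

lemma ae_of_ae_restrict_Ioc_of_periodic {p : ℝ → Prop} {T : ℝ} (hT : 0 < T)
    (hp : Function.Periodic p T) (h : ∀ᵐ θ ∂volume.restrict (Ioc 0 T), p θ) :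
    ∀ᵐ θ : ℝ, p θ := by
  rw [ae_restrict_iff' measurableSet_Ioc] at h
  have hshift : ∀ n : ℤ, ∀ᵐ θ : ℝ, θ - n * T ∈ Ioc 0 T → p (θ - n * T) := fun n =>
    (measurePreserving_sub_right volume ((n : ℝ) * T)).quasiMeasurePreserving.ae h
  filter_upwards [ae_all_iff.2 hshift] with θ hθ
  obtain ⟨n, hn, -⟩ := existsUnique_sub_zsmul_mem_Ioc hT θ 0
  rw [zsmul_eq_mul, zero_add] at hn
  exact hp.sub_int_mul_eq n ▸ hθ n hn

lemma ae_of_ae_discHarmonicMeasure (hz : z ∈ 𝔻) {p : ℂ → Prop}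
    (h : ∀ᵐ θ ∂discHarmonicMeasure z, p (circleMap 0 1 θ)) : ∀ᵐ θ : ℝ, p (circleMap 0 1 θ) := by
  refine ae_of_ae_restrict_Ioc_of_periodic Real.two_pi_pos
    ((periodic_circleMap 0 1).comp p) ((withDensity_absolutelyContinuous' ?_ ?_).ae_le h)
  · exact ((measurable_poissonKernel_circleMap z).const_mul _).ennreal_ofReal.aemeasurable
  · refine Eventually.of_forall fun θ => ?_
    have hnum := one_sub_norm_sq_pos hz
    have hden : 0 < ‖circleMap 0 1 θ - z‖ :=
      norm_pos_iff.2 (sub_ne_zero_of_mem_unitBall hz (by simp))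
    rw [poissonKernel_of_norm_eq_one (by simp)]
    exact (ENNReal.ofReal_pos.2 (by positivity)).ne'

end HarmonicMeasure

section BoundaryValue

/-- The boundary function of `g`, in the angular variable. -/
noncomputable def boundaryValue (g : ℂ → ℂ) (θ : ℝ) : ℂ := radialLimit g (circleMap 0 1 θ)

variable {g h : ℂ → ℂ} {z : ℂ} {M : ℝ}

lemma HasRadialLimit.radialLimit_eq {ξ η : ℂ} (h : HasRadialLimit g ξ η) :
    radialLimit g ξ = η := Tendsto.limUnder_eq h

lemma zero_mem_unitBall : (0 : ℂ) ∈ 𝔻 := Metric.mem_ball_self one_pos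

lemma hasRadialLimit_of_continuousAt {ζ : ℂ} (hg : ContinuousAt g ζ) :
    HasRadialLimit g ζ (g ζ) := by
  have hdil : Continuous fun r : ℝ => (r : ℂ) * ζ := by fun_prop
  refine hg.tendsto.comp (f := fun r : ℝ => (r : ℂ) * ζ) ?_
  simpa using (hdil.tendsto 1).mono_left nhdsWithin_le_nhds

namespace IsBoundedAnalytic

lemma continuousAt (hg : IsBoundedAnalytic g) (hz : z ∈ 𝔻) : ContinuousAt g z :=
  hg.differentiableOn.continuousOn.continuousAt (Metric.isOpen_ball.mem_nhds hz)

protected lemma const (c : ℂ) : IsBoundedAnalytic fun _ => c :=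
  ⟨differentiableOn_const c, ‖c‖, fun _ _ => le_rfl⟩

lemma of_mapsTo (hd : DifferentiableOn ℂ g 𝔻) (hmaps : MapsTo g 𝔻 𝔻) : IsBoundedAnalytic g :=
  ⟨hd, 1, fun _ hz => (mem_ball_zero_iff.1 (hmaps hz)).le⟩

protected lemma mul (hg : IsBoundedAnalytic g) (hh : IsBoundedAnalytic h) :
    IsBoundedAnalytic fun z => g z * h z := by
  obtain ⟨M, hM⟩ := hg.bounded
  obtain ⟨B, hB⟩ := hh.bounded
  refine ⟨hg.differentiableOn.mul hh.differentiableOn, M * B, fun z hz => ?_⟩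
  rw [norm_mul]
  exact mul_le_mul (hM z hz) (hB z hz) (norm_nonneg _) ((norm_nonneg _).trans (hM z hz))

protected lemma pow (hg : IsBoundedAnalytic g) (k : ℕ) : IsBoundedAnalytic fun z => g z ^ k := by
  induction k with
  | zero => simpa using IsBoundedAnalytic.const 1
  | succ k ih => simpa only [pow_succ] using ih.mul hg

protected lemma comp (hg : IsBoundedAnalytic g) (hh : DifferentiableOn ℂ h 𝔻)
    (hmaps : MapsTo h 𝔻 𝔻) : IsBoundedAnalytic (g ∘ h) := by
  obtain ⟨M, hM⟩ := hg.bounded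
  exact ⟨hg.differentiableOn.comp hh hmaps, M, fun z hz => hM _ (hmaps hz)⟩

protected lemma dslope (hh : IsBoundedAnalytic h) : IsBoundedAnalytic (dslope h 0) := by
  obtain ⟨M, hM⟩ := hh.bounded
  have hmaps : MapsTo h 𝔻 (Metric.closedBall (h 0) (M + ‖h 0‖)) := fun z hz =>
    mem_closedBall_iff_norm.2 ((norm_sub_le _ _).trans (by gcongr; exact hM z hz))
  refine ⟨(Complex.differentiableOn_dslope (Metric.ball_mem_nhds _ one_pos)).2 hh.differentiableOn,
    M + ‖h 0‖, fun z hz => ?_⟩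
  simpa using Complex.norm_dslope_le_div_of_mapsTo_ball hh.differentiableOn hmaps hz

lemma ae_hasRadialLimit (hg : IsBoundedAnalytic g) :
    ∀ᵐ θ : ℝ, HasRadialLimit g (circleMap 0 1 θ) (boundaryValue g θ) := by
  filter_upwards [hg.ae_exists_hasRadialLimit] with θ ⟨η, hη⟩
  rwa [boundaryValue, hη.radialLimit_eq]

lemma ae_norm_boundaryValue_le (hg : IsBoundedAnalytic g) (hM : ∀ z ∈ 𝔻, ‖g z‖ ≤ M) :
    ∀ᵐ θ : ℝ, ‖boundaryValue g θ‖ ≤ M := by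
  filter_upwards [hg.ae_hasRadialLimit] with θ hθ
  refine le_of_tendsto hθ.norm ?_
  filter_upwards [Ico_mem_nhdsLT (zero_lt_one' ℝ)] with r hr
  exact hM _ (ofReal_mul_mem_unitBall hr (by simp))

lemma continuous_dilate (hg : IsBoundedAnalytic g) {r : ℝ} (hr : r ∈ Ico 0 1) :
    Continuous fun θ : ℝ => g (r * circleMap 0 1 θ) :=
  hg.differentiableOn.continuousOn.comp_continuous (by fun_prop) fun _ =>
    ofReal_mul_mem_unitBall hr (by simp)

lemma aestronglyMeasurable_boundaryValue (hg : IsBoundedAnalytic g) (z : ℂ) :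
    AEStronglyMeasurable (boundaryValue g) (discHarmonicMeasure z) := by
  classical
  have hmeas : Measurable (Set.piecewise 𝔻 g 0) :=
    hg.differentiableOn.continuousOn.measurable_piecewise continuousOn_const measurableSet_ball
  refine AEStronglyMeasurable.mono_ac (discHarmonicMeasure_absolutelyContinuous z) <|
    aestronglyMeasurable_of_tendsto_ae (𝓝[<] (1 : ℝ))
      (f := fun r θ => Set.piecewise 𝔻 g 0 (r * circleMap 0 1 θ))
      (fun r => (hmeas.comp (by fun_prop)).aestronglyMeasurable) ?_
  filter_upwards [hg.ae_hasRadialLimit] with θ hθ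
  refine Tendsto.congr' ?_ hθ
  filter_upwards [Ico_mem_nhdsLT (zero_lt_one' ℝ)] with r hr
  exact (piecewise_eq_of_mem _ _ _ (ofReal_mul_mem_unitBall hr (by simp))).symm

lemma memLp_boundaryValue (hg : IsBoundedAnalytic g) (hz : z ∈ 𝔻) (p : ENNReal) :
    MemLp (boundaryValue g) p (discHarmonicMeasure z) := by
  have := isProbabilityMeasure_discHarmonicMeasure hz
  obtain ⟨M, hM⟩ := hg.bounded
  exact MemLp.of_bound (hg.aestronglyMeasurable_boundaryValue z) M
    ((discHarmonicMeasure_absolutelyContinuous z).ae_le (hg.ae_norm_boundaryValue_le hM))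

lemma integrable_boundaryValue (hg : IsBoundedAnalytic g) (hz : z ∈ 𝔻) :
    Integrable (boundaryValue g) (discHarmonicMeasure z) :=
  memLp_one_iff_integrable.1 (hg.memLp_boundaryValue hz 1)

lemma integral_dilate (hg : IsBoundedAnalytic g) (hz : z ∈ 𝔻) {r : ℝ} (hr : r ∈ Ico 0 1) :
    ∫ θ, g (r * circleMap 0 1 θ) ∂discHarmonicMeasure z = g (r * z) := by
  rw [integral_discHarmonicMeasure hz fun ζ => g (r * ζ)]
  refine DiffContOnCl.circleAverage_poissonKernel_smul (f := fun ζ => g (r * ζ)) ?_ hz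
  refine DifferentiableOn.diffContOnCl ?_
  rw [closure_ball _ one_ne_zero]
  exact hg.differentiableOn.comp (by fun_prop) fun ζ hζ =>
    ofReal_mul_mem_unitBall hr (mem_closedBall_zero_iff.1 hζ)

lemma tendsto_integral_mul_dilate (hg : IsBoundedAnalytic g) {X : ℝ → ℂ}
    (hX : Integrable X (discHarmonicMeasure z)) {Φ : ℂ → ℂ} (hΦ : Continuous Φ) :
    Tendsto (fun r : ℝ => ∫ θ, X θ * Φ (g (r * circleMap 0 1 θ)) ∂discHarmonicMeasure z) (𝓝[<] 1)
      (𝓝 (∫ θ, X θ * Φ (boundaryValue g θ) ∂discHarmonicMeasure z)) := by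
  obtain ⟨M, hM⟩ := hg.bounded
  obtain ⟨B, hB⟩ := (isCompact_closedBall (0 : ℂ) M).exists_bound_of_continuousOn hΦ.continuousOn
  refine tendsto_integral_filter_of_dominated_convergence (fun θ => ‖X θ‖ * B) ?_ ?_
    (hX.norm.mul_const B) ?_
  · filter_upwards [Ico_mem_nhdsLT (zero_lt_one' ℝ)] with r hr
    exact hX.aestronglyMeasurable.mul (hΦ.comp (hg.continuous_dilate hr)).aestronglyMeasurable
  · filter_upwards [Ico_mem_nhdsLT (zero_lt_one' ℝ)] with r hr
    refine Eventually.of_forall fun θ => ?_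
    rw [norm_mul]
    gcongr
    exact hB _ (mem_closedBall_zero_iff.2 (hM _ (ofReal_mul_mem_unitBall hr (by simp))))
  · filter_upwards [(discHarmonicMeasure_absolutelyContinuous z).ae_le hg.ae_hasRadialLimit]
      with θ hθ
    exact ((hΦ.tendsto _).comp hθ).const_mul (X θ)

theorem integral_boundaryValue (hg : IsBoundedAnalytic g) (hz : z ∈ 𝔻) :
    ∫ θ, boundaryValue g θ ∂discHarmonicMeasure z = g z := by
  have := isProbabilityMeasure_discHarmonicMeasure hz
  have hlim := hg.tendsto_integral_mul_dilate (z := z) (integrable_const 1) continuous_id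
  simp only [one_mul, id] at hlim
  refine tendsto_nhds_unique (hlim.congr' ?_) (hasRadialLimit_of_continuousAt (hg.continuousAt hz))
  filter_upwards [Ico_mem_nhdsLT (zero_lt_one' ℝ)] with r hr
  exact hg.integral_dilate hz hr

lemma ae_boundaryValue_mul (hg : IsBoundedAnalytic g) (hh : IsBoundedAnalytic h) :
    ∀ᵐ θ : ℝ, boundaryValue (fun z => g z * h z) θ = boundaryValue g θ * boundaryValue h θ := by
  filter_upwards [hg.ae_hasRadialLimit, hh.ae_hasRadialLimit] with θ hgθ hhθ
  exact HasRadialLimit.radialLimit_eq (Tendsto.mul hgθ hhθ)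

lemma ae_boundaryValue_pow (hg : IsBoundedAnalytic g) (k : ℕ) :
    ∀ᵐ θ : ℝ, boundaryValue (fun z => g z ^ k) θ = boundaryValue g θ ^ k := by
  filter_upwards [hg.ae_hasRadialLimit] with θ hgθ
  exact HasRadialLimit.radialLimit_eq (Tendsto.pow hgθ k)

lemma integral_conj_boundaryValue_pow (hg : IsBoundedAnalytic g) (hz : z ∈ 𝔻) (k : ℕ) :
    ∫ θ, (starRingEnd ℂ) (boundaryValue g θ) ^ k ∂discHarmonicMeasure z =
      (starRingEnd ℂ) (g z) ^ k := by
  have hpow := (discHarmonicMeasure_absolutelyContinuous z).ae_le (hg.ae_boundaryValue_pow k)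
  simp only [← map_pow]
  rw [integral_conj, ← (hg.pow k).integral_boundaryValue hz, integral_congr_ae hpow]

end IsBoundedAnalytic

end BoundaryValue

section Composition

variable {f g F : ℂ → ℂ} {z : ℂ}

lemma integrable_mul_conj_pow {α : Type*} [MeasurableSpace α] {μ : Measure α} {X Y : α → ℂ}
    (hX : Integrable X μ) (hY : AEStronglyMeasurable Y μ) (hYnorm : ∀ᵐ θ ∂μ, ‖Y θ‖ ≤ 1) (k : ℕ) :
    Integrable (fun θ => X θ * (starRingEnd ℂ) (Y θ) ^ k) μ := by
  refine hX.mul_bdd (c := 1)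
    ((Complex.continuous_conj.pow k).comp_aestronglyMeasurable hY) ?_
  filter_upwards [hYnorm] with θ hθ
  rw [norm_pow, RCLike.norm_conj]
  exact pow_le_one₀ (norm_nonneg _) hθ

lemma hasSum_integral_mul_conj_comp {α : Type*} [MeasurableSpace α] {μ : Measure α} {X Y : α → ℂ}
    (hX : Integrable X μ) (hY : AEStronglyMeasurable Y μ) (hYnorm : ∀ᵐ θ ∂μ, ‖Y θ‖ ≤ 1)
    (hf : DifferentiableOn ℂ f 𝔻) {r : ℝ} (hr : r ∈ Ico 0 1) :
    HasSum (fun k : ℕ => (starRingEnd ℂ) ((k.factorial : ℂ)⁻¹ * r ^ k * iteratedDeriv k f 0) *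
        ∫ θ, X θ * (starRingEnd ℂ) (Y θ) ^ k ∂μ)
      (∫ θ, X θ * (starRingEnd ℂ) (f (r * Y θ)) ∂μ) := by
  set c : ℕ → ℂ := fun k => (k.factorial : ℂ)⁻¹ * r ^ k * iteratedDeriv k f 0
  have htaylor : ∀ y : ℂ, ‖y‖ ≤ 1 → HasSum (fun k => c k * y ^ k) (f (r * y)) := fun y hy => by
    refine (Complex.hasSum_taylorSeries_on_ball hf (ofReal_mul_mem_unitBall hr hy)).congr_fun
      fun k => ?_
    simp only [c, sub_zero, smul_eq_mul, mul_pow]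
    ring
  have hc : Summable fun k => ‖c k‖ := by
    simpa using (htaylor 1 (by simp)).summable.norm
  have hinteg := fun k => (integrable_mul_conj_pow hX hY hYnorm k).const_mul ((starRingEnd ℂ) (c k))
  simp only [← integral_const_mul]
  refine hasSum_integral_of_dominated_convergence (fun k θ => ‖c k‖ * ‖X θ‖)
    (fun k => (hinteg k).aestronglyMeasurable) (fun k => ?_)
    (Eventually.of_forall fun θ => hc.mul_right _) ?_ ?_
  · filter_upwards [hYnorm] with θ hθ
    rw [norm_mul, norm_mul, norm_pow, RCLike.norm_conj, RCLike.norm_conj]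
    exact mul_le_mul_of_nonneg_left
      (mul_le_of_le_one_right (norm_nonneg _) (pow_le_one₀ (norm_nonneg _) hθ)) (norm_nonneg _)
  · simp only [tsum_mul_right]
    exact hX.norm.const_mul _
  · filter_upwards [hYnorm] with θ hθ
    have hconj := ((htaylor (Y θ) hθ).map (starRingEnd ℂ) Complex.continuous_conj).mul_left (X θ)
    refine hconj.congr_fun fun k => ?_
    simp only [c, Function.comp_apply, map_mul, map_pow]
    ring

lemma eq_add_mul_dslope_zero (F : ℂ → ℂ) (w : ℂ) : F w = F 0 + w * dslope F 0 w := by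
  have h := sub_smul_dslope F 0 w
  rw [sub_zero, smul_eq_mul] at h
  rw [h, add_sub_cancel]

lemma isInnerFunction_id : IsInnerFunction id where
  differentiableOn := differentiableOn_id
  mapsTo := mapsTo_id _
  ae_radialLimit := Eventually.of_forall fun _ =>
    ⟨_, by simp, hasRadialLimit_of_continuousAt continuousAt_id⟩

lemma boundaryValue_id : boundaryValue id = circleMap 0 1 :=
  funext fun _ => (hasRadialLimit_of_continuousAt continuousAt_id).radialLimit_eq

namespace IsInnerFunction

lemma norm_le_one (hg : IsInnerFunction g) (hz : z ∈ 𝔻) : ‖g z‖ ≤ 1 :=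
  (mem_ball_zero_iff.1 (hg.mapsTo hz)).le

lemma isBoundedAnalytic (hg : IsInnerFunction g) : IsBoundedAnalytic g :=
  .of_mapsTo hg.differentiableOn hg.mapsTo

lemma ae_norm_boundaryValue (hg : IsInnerFunction g) : ∀ᵐ θ : ℝ, ‖boundaryValue g θ‖ = 1 := by
  filter_upwards [hg.ae_radialLimit] with θ ⟨η, hη, hlim⟩
  rwa [boundaryValue, hlim.radialLimit_eq]

lemma ae_discHarmonicMeasure_norm_le_one (hg : IsInnerFunction g) (z : ℂ) :
    ∀ᵐ θ ∂discHarmonicMeasure z, ‖boundaryValue g θ‖ ≤ 1 := by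
  filter_upwards [(discHarmonicMeasure_absolutelyContinuous z).ae_le hg.ae_norm_boundaryValue]
    with θ hθ using hθ.le

lemma integrable_mul_conj_boundaryValue_pow (hg : IsInnerFunction g) (hF : IsBoundedAnalytic F)
    (hz : z ∈ 𝔻) (k : ℕ) :
    Integrable (fun θ => boundaryValue F θ * (starRingEnd ℂ) (boundaryValue g θ) ^ k)
      (discHarmonicMeasure z) :=
  integrable_mul_conj_pow (hF.integrable_boundaryValue hz)
    (hg.isBoundedAnalytic.aestronglyMeasurable_boundaryValue z)
    (hg.ae_discHarmonicMeasure_norm_le_one z) k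

lemma ae_boundaryValue_comp (hg : IsInnerFunction g) (hF : IsBoundedAnalytic F) :
    ∀ᵐ θ : ℝ, boundaryValue (F ∘ g) θ =
      F 0 + boundaryValue g θ * boundaryValue (dslope F 0 ∘ g) θ := by
  have hslope := hF.dslope.comp hg.differentiableOn hg.mapsTo
  filter_upwards [hg.isBoundedAnalytic.ae_hasRadialLimit, hslope.ae_hasRadialLimit]
    with θ hgθ hslopeθ
  refine HasRadialLimit.radialLimit_eq ?_
  rw [show F ∘ g = _ from funext fun w => eq_add_mul_dslope_zero F (g w)]
  exact (Tendsto.mul hgθ hslopeθ).const_add (F 0)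

lemma integral_comp_mul_conj_pow_succ (hg : IsInnerFunction g) (hF : IsBoundedAnalytic F)
    (hz : z ∈ 𝔻) (k : ℕ) :
    ∫ θ, boundaryValue (F ∘ g) θ * (starRingEnd ℂ) (boundaryValue g θ) ^ (k + 1)
        ∂discHarmonicMeasure z =
      F 0 * (starRingEnd ℂ) (g z) ^ (k + 1) +
        ∫ θ, boundaryValue (dslope F 0 ∘ g) θ * (starRingEnd ℂ) (boundaryValue g θ) ^ k
          ∂discHarmonicMeasure z := by
  have := isProbabilityMeasure_discHarmonicMeasure hz
  have hexpand : ∀ᵐ θ ∂discHarmonicMeasure z,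
      boundaryValue (F ∘ g) θ * (starRingEnd ℂ) (boundaryValue g θ) ^ (k + 1) =
        F 0 * (starRingEnd ℂ) (boundaryValue g θ) ^ (k + 1) +
          boundaryValue (dslope F 0 ∘ g) θ *
            (starRingEnd ℂ) (boundaryValue g θ) ^ k := by
    refine (discHarmonicMeasure_absolutelyContinuous z).ae_le ?_
    filter_upwards [hg.ae_boundaryValue_comp hF, hg.ae_norm_boundaryValue] with θ hcomp hnorm
    have hunit : boundaryValue g θ * (starRingEnd ℂ) (boundaryValue g θ) = 1 := by
      rw [Complex.mul_conj', hnorm]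
      norm_num
    rw [hcomp, pow_succ]
    linear_combination boundaryValue (dslope F 0 ∘ g) θ *
      (starRingEnd ℂ) (boundaryValue g θ) ^ k * hunit
  rw [integral_congr_ae hexpand, integral_add, integral_const_mul,
    hg.isBoundedAnalytic.integral_conj_boundaryValue_pow hz]
  · exact integrable_mul_conj_pow (integrable_const (F 0))
      (hg.isBoundedAnalytic.aestronglyMeasurable_boundaryValue z)
      (hg.ae_discHarmonicMeasure_norm_le_one z) _
  · exact hg.integrable_mul_conj_boundaryValue_pow
      (hF.dslope.comp hg.differentiableOn hg.mapsTo) hz k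

-- Both sides satisfy the same recursion in `k`: the right side is the left side for `g = id`.
lemma integral_comp_mul_conj_pow (hg : IsInnerFunction g) (hF : IsBoundedAnalytic F)
    (hz : z ∈ 𝔻) (k : ℕ) :
    ∫ θ, boundaryValue (F ∘ g) θ * (starRingEnd ℂ) (boundaryValue g θ) ^ k
        ∂discHarmonicMeasure z =
      ∫ θ, boundaryValue F θ * (starRingEnd ℂ) (circleMap 0 1 θ) ^ k
        ∂discHarmonicMeasure (g z) := by
  induction k generalizing F with
  | zero =>
    simp only [pow_zero, mul_one]
    rw [(hF.comp hg.differentiableOn hg.mapsTo).integral_boundaryValue hz,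
      hF.integral_boundaryValue (hg.mapsTo hz), Function.comp_apply]
  | succ k ih =>
    have hid := isInnerFunction_id.integral_comp_mul_conj_pow_succ hF (hg.mapsTo hz) k
    simp only [boundaryValue_id, Function.comp_id, id] at hid
    rw [hg.integral_comp_mul_conj_pow_succ hF hz, hid, ih hF.dslope]

lemma integral_comp_mul_conj_dilate (hg : IsInnerFunction g) (hF : IsBoundedAnalytic F)
    (hf : DifferentiableOn ℂ f 𝔻) (hz : z ∈ 𝔻) {r : ℝ} (hr : r ∈ Ico 0 1) :
    ∫ θ, boundaryValue (F ∘ g) θ * (starRingEnd ℂ) (f (r * boundaryValue g θ))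
        ∂discHarmonicMeasure z =
      ∫ θ, boundaryValue F θ * (starRingEnd ℂ) (f (r * circleMap 0 1 θ))
        ∂discHarmonicMeasure (g z) := by
  have hsum := hasSum_integral_mul_conj_comp
    ((hF.comp hg.differentiableOn hg.mapsTo).integrable_boundaryValue hz)
    (hg.isBoundedAnalytic.aestronglyMeasurable_boundaryValue z)
    (hg.ae_discHarmonicMeasure_norm_le_one z) hf hr
  have hsum_id := hasSum_integral_mul_conj_comp (hF.integrable_boundaryValue (hg.mapsTo hz))
    (continuous_circleMap 0 1).aestronglyMeasurable (Eventually.of_forall fun θ => by simp) hf hr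
  simp only [hg.integral_comp_mul_conj_pow hF hz] at hsum
  exact hsum.unique hsum_id

lemma one_le_integral_norm_boundaryValue_comp (hf : IsInnerFunction f) (hg : IsInnerFunction g)
    (hz : z ∈ 𝔻) :
    1 ≤ ∫ θ, ‖boundaryValue (f ∘ g) θ‖ ∂discHarmonicMeasure z := by
  have := isProbabilityMeasure_discHarmonicMeasure (hg.mapsTo hz)
  have hfb := hf.isBoundedAnalytic
  have hcomp := (hfb.comp hg.differentiableOn hg.mapsTo).integrable_boundaryValue hz
  have hlim := (hfb.tendsto_integral_mul_dilate
    (hfb.integrable_boundaryValue (hg.mapsTo hz)) Complex.continuous_conj).norm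
  have hunit : ∫ θ, boundaryValue f θ * (starRingEnd ℂ) (boundaryValue f θ)
      ∂discHarmonicMeasure (g z) = 1 := by
    have hae : ∀ᵐ θ ∂discHarmonicMeasure (g z),
        boundaryValue f θ * (starRingEnd ℂ) (boundaryValue f θ) = 1 := by
      filter_upwards [(discHarmonicMeasure_absolutelyContinuous _).ae_le hf.ae_norm_boundaryValue]
        with θ hθ
      simp [Complex.mul_conj', hθ]
    simp [integral_congr_ae hae]
  rw [hunit, norm_one] at hlim
  refine le_of_tendsto hlim ?_
  filter_upwards [Ico_mem_nhdsLT (zero_lt_one' ℝ)] with r hr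
  rw [← hg.integral_comp_mul_conj_dilate hfb hf.differentiableOn hz hr]
  refine norm_integral_le_of_norm_le hcomp.norm ?_
  filter_upwards [hg.ae_discHarmonicMeasure_norm_le_one z] with θ hθ
  rw [norm_mul, RCLike.norm_conj]
  exact mul_le_of_le_one_right (norm_nonneg _)
    (hf.norm_le_one (ofReal_mul_mem_unitBall hr hθ))

theorem comp (hf : IsInnerFunction f) (hg : IsInnerFunction g) : IsInnerFunction (f ∘ g) := by
  have := isProbabilityMeasure_discHarmonicMeasure zero_mem_unitBall
  have hmaps := hf.mapsTo.comp hg.mapsTo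
  have hcomp := hf.isBoundedAnalytic.comp hg.differentiableOn hg.mapsTo
  have hle : ∀ᵐ θ ∂discHarmonicMeasure 0, ‖boundaryValue (f ∘ g) θ‖ ≤ 1 :=
    (discHarmonicMeasure_absolutelyContinuous 0).ae_le <|
      hcomp.ae_norm_boundaryValue_le fun _ hz => (mem_ball_zero_iff.1 (hmaps hz)).le
  have hnonneg : 0 ≤ᵐ[discHarmonicMeasure 0] fun θ => 1 - ‖boundaryValue (f ∘ g) θ‖ := by
    filter_upwards [hle] with θ hθ using sub_nonneg.2 hθ
  have hinteg := (hcomp.integrable_boundaryValue zero_mem_unitBall).norm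
  have hzero : ∫ θ, (1 - ‖boundaryValue (f ∘ g) θ‖) ∂discHarmonicMeasure 0 = 0 := by
    refine le_antisymm ?_ (integral_nonneg_of_ae hnonneg)
    rw [integral_sub (integrable_const 1) hinteg]
    simpa using hf.one_le_integral_norm_boundaryValue_comp hg zero_mem_unitBall
  have hae := (integral_eq_zero_iff_of_nonneg_ae hnonneg ((integrable_const 1).sub hinteg)).1 hzero
  have hnorm : ∀ᵐ θ : ℝ, ‖boundaryValue (f ∘ g) θ‖ = 1 :=
    ae_of_ae_discHarmonicMeasure zero_mem_unitBall (p := fun ζ => ‖radialLimit (f ∘ g) ζ‖ = 1)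
      (hae.mono fun θ hθ => (sub_eq_zero.1 hθ).symm)
  refine ⟨hf.differentiableOn.comp hg.differentiableOn hg.mapsTo, hmaps, ?_⟩
  filter_upwards [hnorm, hcomp.ae_hasRadialLimit] with θ hθ hlim using ⟨_, hθ, hlim⟩

theorem iterate (hf : IsInnerFunction f) (n : ℕ) : IsInnerFunction (f^[n]) := by
  induction n with
  | zero => exact isInnerFunction_id
  | succ n ih => exact ih.comp hf

end IsInnerFunction

end Composition

section SchwarzPick

variable {f h : ℂ → ℂ} {w z : ℂ}

lemma norm_one_sub_conj_mul_sq_sub_norm_sub_sq (a b : ℂ) :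
    ‖1 - (starRingEnd ℂ) a * b‖ ^ 2 - ‖b - a‖ ^ 2 = (1 - ‖a‖ ^ 2) * (1 - ‖b‖ ^ 2) := by
  simp only [← Complex.normSq_eq_norm_sq, Complex.normSq_apply, Complex.sub_re, Complex.sub_im,
    Complex.mul_re, Complex.mul_im, Complex.conj_re, Complex.conj_im, Complex.one_re,
    Complex.one_im]
  ring

lemma one_sub_norm_le_norm_one_sub_conj_mul {a b : ℂ} (hb : ‖b‖ ≤ 1) :
    1 - ‖a‖ ≤ ‖1 - (starRingEnd ℂ) a * b‖ := by
  have htri := norm_sub_norm_le (1 : ℂ) ((starRingEnd ℂ) a * b)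
  rw [norm_one, norm_mul, RCLike.norm_conj] at htri
  linarith [mul_le_of_le_one_right (norm_nonneg a) hb]

/-- **Schwarz–Pick inequality** at the origin. -/
lemma norm_sub_le_of_mapsTo_unitBall (hd : DifferentiableOn ℂ h 𝔻) (hmaps : MapsTo h 𝔻 𝔻)
    (hw : w ∈ 𝔻) : ‖h w - h 0‖ ≤ ‖w‖ * ‖1 - (starRingEnd ℂ) (h 0) * h w‖ := by
  have hpos : ∀ z ∈ 𝔻, 0 < ‖1 - (starRingEnd ℂ) (h 0) * h z‖ := fun z hz =>
    (sub_pos.2 (mem_ball_zero_iff.1 (hmaps zero_mem_unitBall))).trans_le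
      (one_sub_norm_le_norm_one_sub_conj_mul (mem_ball_zero_iff.1 (hmaps hz)).le)
  set φ : ℂ → ℂ := fun z => (h z - h 0) / (1 - (starRingEnd ℂ) (h 0) * h z) with hφ
  have hφd : DifferentiableOn ℂ φ 𝔻 :=
    (hd.sub_const _).div ((hd.const_mul _).const_sub _) fun z hz => norm_pos_iff.1 (hpos z hz)
  have hφ0 : φ 0 = 0 := by simp only [hφ, sub_self, zero_div]
  have hφmaps : MapsTo φ 𝔻 (Metric.closedBall 0 1) := fun z hz => by
    rw [mem_closedBall_zero_iff, norm_div, div_le_one (hpos z hz)]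
    refine (sq_le_sq₀ (norm_nonneg _) (norm_nonneg _)).1 ?_
    have hid := norm_one_sub_conj_mul_sq_sub_norm_sub_sq (h 0) (h z)
    have hprod := mul_pos (one_sub_norm_sq_pos (hmaps zero_mem_unitBall))
      (one_sub_norm_sq_pos (hmaps hz))
    linarith
  have hschwarz := Complex.norm_le_norm_of_mapsTo_ball hφd hφmaps hφ0 (mem_ball_zero_iff.1 hw)
  rwa [norm_div, div_le_iff₀ (hpos w hw)] at hschwarz

lemma one_sub_norm_sq_mul_le_of_mapsTo_unitBall (hd : DifferentiableOn ℂ h 𝔻)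
    (hmaps : MapsTo h 𝔻 𝔻) (hw : w ∈ 𝔻) :
    (1 - ‖w‖ ^ 2) * (1 - ‖h 0‖) ≤ (1 + ‖h 0‖) * (1 - ‖h w‖ ^ 2) := by
  have hpos : 0 < 1 - ‖h 0‖ := sub_pos.2 (mem_ball_zero_iff.1 (hmaps zero_mem_unitBall))
  have hdenom := one_sub_norm_le_norm_one_sub_conj_mul (a := h 0)
    (mem_ball_zero_iff.1 (hmaps hw)).le
  have hpick := pow_le_pow_left₀ (norm_nonneg _) (norm_sub_le_of_mapsTo_unitBall hd hmaps hw) 2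
  refine le_of_mul_le_mul_right ?_ hpos
  calc (1 - ‖w‖ ^ 2) * (1 - ‖h 0‖) * (1 - ‖h 0‖)
      = (1 - ‖w‖ ^ 2) * (1 - ‖h 0‖) ^ 2 := by ring
    _ ≤ (1 - ‖w‖ ^ 2) * ‖1 - (starRingEnd ℂ) (h 0) * h w‖ ^ 2 := by
        gcongr
        exact (one_sub_norm_sq_pos hw).le
    _ ≤ ‖1 - (starRingEnd ℂ) (h 0) * h w‖ ^ 2 - ‖h w - h 0‖ ^ 2 := by
        rw [mul_pow] at hpick
        linarith
    _ = (1 + ‖h 0‖) * (1 - ‖h w‖ ^ 2) * (1 - ‖h 0‖) := by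
        rw [norm_one_sub_conj_mul_sq_sub_norm_sub_sq]
        ring

lemma norm_sq_mul_one_sub_norm_sq_le (hd : DifferentiableOn ℂ h 𝔻) (hmaps : MapsTo h 𝔻 𝔻)
    (hw : w ∈ 𝔻) :
    ‖h w‖ ^ 2 * (1 - ‖w‖ ^ 2) ≤ (1 + ‖h 0‖) / 2 * (1 - ‖w * h w‖ ^ 2) := by
  have hpick := one_sub_norm_sq_mul_le_of_mapsTo_unitBall hd hmaps hw
  have hnonneg : 0 ≤ (1 - ‖w‖ ^ 2) * (1 - ‖h 0‖) :=
    mul_nonneg (one_sub_norm_sq_pos hw).le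
      (sub_nonneg.2 (mem_ball_zero_iff.1 (hmaps zero_mem_unitBall)).le)
  have hshrink := mul_le_of_le_one_left hnonneg
    (sub_nonneg.1 (one_sub_norm_sq_pos (hmaps hw)).le)
  rw [norm_mul, mul_pow]
  linarith

lemma mapsTo_dslope_zero (hd : DifferentiableOn ℂ f 𝔻) (hmaps : MapsTo f 𝔻 𝔻) (hf0 : f 0 = 0)
    (hrot : ¬ IsDiscRotation f) : MapsTo (dslope f 0) 𝔻 𝔻 := by
  intro z hz
  have hclosed : MapsTo f 𝔻 (Metric.closedBall (f 0) 1) :=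
    hf0.symm ▸ hmaps.mono_right Metric.ball_subset_closedBall
  have hle : ‖dslope f 0 z‖ ≤ 1 := by
    simpa using Complex.norm_dslope_le_div_of_mapsTo_ball hd hclosed hz
  refine mem_ball_zero_iff.2 (hle.lt_of_ne fun hone => hrot ⟨dslope f 0 z, hone, fun w hw => ?_⟩)
  have haffine := Complex.affine_of_mapsTo_ball_of_norm_dslope_eq_div hd hclosed hz (by simpa)
  simpa [hf0, mul_comm] using haffine hw

end SchwarzPick

section Iterates

variable {f : ℂ → ℂ} {z : ℂ}

/-- The quotient `f^[j] z / z`, extended analytically over `z = 0`, for `f` fixing the origin. -/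
noncomputable def iterateQuotient (f : ℂ → ℂ) (j : ℕ) (z : ℂ) : ℂ :=
  ∏ i ∈ Finset.range j, dslope f 0 (f^[i] z)

/-- The geometric rate at which correlations between the iterates of `f` decay. -/
noncomputable def correlationRate (f : ℂ → ℂ) : ℝ := √((1 + ‖dslope f 0 0‖) / 2)

lemma iterateQuotient_zero (f : ℂ → ℂ) : iterateQuotient f 0 = fun _ => 1 := rfl

lemma iterateQuotient_succ (f : ℂ → ℂ) (j : ℕ) (z : ℂ) :
    iterateQuotient f (j + 1) z = iterateQuotient f j z * dslope f 0 (f^[j] z) :=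
  Finset.prod_range_succ _ _

lemma eq_mul_dslope_zero (hf0 : f 0 = 0) (z : ℂ) : f z = z * dslope f 0 z := by
  rw [eq_add_mul_dslope_zero f z, hf0, zero_add]

lemma iterate_eq_mul_iterateQuotient (hf0 : f 0 = 0) (j : ℕ) (z : ℂ) :
    f^[j] z = z * iterateQuotient f j z := by
  induction j with
  | zero => simp [iterateQuotient_zero]
  | succ j ih =>
    rw [Function.iterate_succ_apply', eq_mul_dslope_zero hf0, iterateQuotient_succ, ← mul_assoc,
      ← ih]

lemma isBoundedAnalytic_iterateQuotient (hd : DifferentiableOn ℂ f 𝔻) (hmaps : MapsTo f 𝔻 𝔻)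
    (j : ℕ) : IsBoundedAnalytic (iterateQuotient f j) := by
  induction j with
  | zero => exact .const 1
  | succ j ih =>
    rw [show iterateQuotient f (j + 1) = _ from funext (iterateQuotient_succ f j)]
    exact ih.mul ((IsBoundedAnalytic.of_mapsTo hd hmaps).dslope.comp (hd.iterate hmaps j)
      (hmaps.iterate j))

lemma correlationRate_nonneg (f : ℂ → ℂ) : 0 ≤ correlationRate f := Real.sqrt_nonneg _

lemma correlationRate_lt_one (hmaps : MapsTo (dslope f 0) 𝔻 𝔻) : correlationRate f < 1 := by
  have hslope := mem_ball_zero_iff.1 (hmaps zero_mem_unitBall)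
  rw [correlationRate, Real.sqrt_lt' one_pos]
  linarith

lemma norm_dslope_mul_sqrt_le (hd : DifferentiableOn ℂ f 𝔻) (hmaps : MapsTo (dslope f 0) 𝔻 𝔻)
    (hf0 : f 0 = 0) (hz : z ∈ 𝔻) :
    ‖dslope f 0 z‖ * √(1 - ‖z‖ ^ 2) ≤ correlationRate f * √(1 - ‖f z‖ ^ 2) := by
  have hslope : DifferentiableOn ℂ (dslope f 0) 𝔻 :=
    (Complex.differentiableOn_dslope (Metric.ball_mem_nhds _ one_pos)).2 hd
  have hpick := Real.sqrt_le_sqrt (norm_sq_mul_one_sub_norm_sq_le hslope hmaps hz)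
  rwa [Real.sqrt_mul (by positivity), Real.sqrt_sq (norm_nonneg _), Real.sqrt_mul (by positivity),
    ← eq_mul_dslope_zero hf0] at hpick

lemma norm_iterateQuotient_mul_sqrt_le (hd : DifferentiableOn ℂ f 𝔻) (hmaps : MapsTo f 𝔻 𝔻)
    (hslope : MapsTo (dslope f 0) 𝔻 𝔻) (hf0 : f 0 = 0) (j : ℕ) (hz : z ∈ 𝔻) :
    ‖iterateQuotient f j z‖ * √(1 - ‖z‖ ^ 2) ≤
      correlationRate f ^ j * √(1 - ‖f^[j] z‖ ^ 2) := by
  induction j with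
  | zero => simp [iterateQuotient_zero]
  | succ j ih =>
    have hstep := norm_dslope_mul_sqrt_le hd hslope hf0 (hmaps.iterate j hz)
    rw [← Function.iterate_succ_apply' f] at hstep
    rw [iterateQuotient_succ, norm_mul]
    calc ‖iterateQuotient f j z‖ * ‖dslope f 0 (f^[j] z)‖ * √(1 - ‖z‖ ^ 2)
        = ‖dslope f 0 (f^[j] z)‖ * (‖iterateQuotient f j z‖ * √(1 - ‖z‖ ^ 2)) := by ring
      _ ≤ ‖dslope f 0 (f^[j] z)‖ * (correlationRate f ^ j * √(1 - ‖f^[j] z‖ ^ 2)) := by gcongr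
      _ = correlationRate f ^ j * (‖dslope f 0 (f^[j] z)‖ * √(1 - ‖f^[j] z‖ ^ 2)) := by ring
      _ ≤ correlationRate f ^ j * (correlationRate f * √(1 - ‖f^[j + 1] z‖ ^ 2)) := by
          gcongr
          exact pow_nonneg (correlationRate_nonneg f) j
      _ = correlationRate f ^ (j + 1) * √(1 - ‖f^[j + 1] z‖ ^ 2) := by ring

end Iterates

section SchurTest

lemma sum_pow_le_of_injOn {ι : Type*} {c : ℝ} (hc0 : 0 ≤ c) (hc1 : c < 1) {s : Finset ι}
    {e : ι → ℕ} (he : InjOn e s) : ∑ k ∈ s, c ^ e k ≤ 1 / (1 - c) := by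
  rw [← Finset.sum_image he, one_div, ← tsum_geometric_of_lt_one hc0 hc1]
  exact (summable_geometric_of_lt_one hc0 hc1).sum_le_tsum _ fun _ _ => by positivity

lemma sum_pow_dist_le {c : ℝ} (hc0 : 0 ≤ c) (hc1 : c < 1) (s : Finset ℕ) (n : ℕ) :
    ∑ k ∈ s, c ^ n.dist k ≤ 2 / (1 - c) := by
  have hleft : InjOn n.dist (s.filter (· ≤ n)) := fun i hi j hj hij => by
    have hin := (Finset.mem_filter.1 hi).2
    have hjn := (Finset.mem_filter.1 hj).2
    rw [Nat.dist_eq_sub_of_le_right hin, Nat.dist_eq_sub_of_le_right hjn] at hij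
    lia
  have hright : InjOn n.dist (s.filter (¬ · ≤ n)) := fun i hi j hj hij => by
    have hni := (not_le.1 (Finset.mem_filter.1 hi).2).le
    have hnj := (not_le.1 (Finset.mem_filter.1 hj).2).le
    rw [Nat.dist_eq_sub_of_le hni, Nat.dist_eq_sub_of_le hnj] at hij
    lia
  rw [← Finset.sum_filter_add_sum_filter_not s (· ≤ n), ← one_add_one_eq_two, add_div]
  exact add_le_add (sum_pow_le_of_injOn hc0 hc1 hleft) (sum_pow_le_of_injOn hc0 hc1 hright)

/-- **Schur test** for a symmetric kernel. -/
lemma sum_sum_mul_le_of_sum_le {ι : Type*} {s : Finset ι} {K : ι → ι → ℝ} {B : ℝ}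
    (hK : ∀ n k, 0 ≤ K n k) (hsymm : ∀ n k, K n k = K k n) (hB : ∀ n, ∑ k ∈ s, K n k ≤ B)
    (x : ι → ℝ) :
    ∑ n ∈ s, ∑ k ∈ s, K n k * (x n * x k) ≤ B * ∑ n ∈ s, x n ^ 2 := by
  have hswap : ∑ n ∈ s, ∑ k ∈ s, K n k * x k ^ 2 = ∑ n ∈ s, ∑ k ∈ s, K n k * x n ^ 2 := by
    rw [Finset.sum_comm]
    exact Finset.sum_congr rfl fun k _ => Finset.sum_congr rfl fun n _ => by rw [hsymm]
  calc ∑ n ∈ s, ∑ k ∈ s, K n k * (x n * x k)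
      ≤ ∑ n ∈ s, ∑ k ∈ s, (K n k * x n ^ 2 + K n k * x k ^ 2) / 2 := by
        refine Finset.sum_le_sum fun n _ => Finset.sum_le_sum fun k _ => ?_
        linarith [mul_nonneg (hK n k) (sq_nonneg (x n - x k))]
    _ = ∑ n ∈ s, (∑ k ∈ s, K n k) * x n ^ 2 := by
        simp only [← Finset.sum_div, Finset.sum_add_distrib, hswap, Finset.sum_mul]
        ring
    _ ≤ B * ∑ n ∈ s, x n ^ 2 := by
        rw [Finset.mul_sum]
        exact Finset.sum_le_sum fun n _ => mul_le_mul_of_nonneg_right (hB n) (sq_nonneg _)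

end SchurTest

section SecondMoment

variable {α : Type*} [MeasurableSpace α] {μ : Measure α}

lemma integrable_mul_conj {X Y : α → ℂ} (hX : MemLp X 2 μ) (hY : MemLp Y 2 μ) :
    Integrable (fun θ => X θ * (starRingEnd ℂ) (Y θ)) μ :=
  hX.integrable_mul hY.star

lemma integral_sub_mul_conj_sub [IsProbabilityMeasure μ] {X Y : α → ℂ} (hX : MemLp X 2 μ)
    (hY : MemLp Y 2 μ) :
    ∫ θ, (X θ - ∫ t, X t ∂μ) * (starRingEnd ℂ) (Y θ - ∫ t, Y t ∂μ) ∂μ =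
      ∫ θ, X θ * (starRingEnd ℂ) (Y θ) ∂μ -
        (∫ θ, X θ ∂μ) * (starRingEnd ℂ) (∫ θ, Y θ ∂μ) := by
  set m := ∫ θ, X θ ∂μ
  set m' := ∫ θ, Y θ ∂μ
  have hcentre : ∫ θ, (X θ - m) * (starRingEnd ℂ) m' ∂μ = 0 := by
    rw [integral_mul_const, integral_sub (hX.integrable one_le_two) (integrable_const m)]
    simp [m]
  have hexpand : ∀ θ, (X θ - m) * (starRingEnd ℂ) (Y θ - m') =
      X θ * (starRingEnd ℂ) (Y θ) - m * (starRingEnd ℂ) (Y θ) - (X θ - m) * (starRingEnd ℂ) m' :=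
    fun θ => by rw [map_sub]; ring
  have hmY : Integrable (fun θ => m * (starRingEnd ℂ) (Y θ)) μ :=
    integrable_mul_conj (memLp_const m) hY
  have hleft : Integrable (fun θ => X θ * (starRingEnd ℂ) (Y θ) - m * (starRingEnd ℂ) (Y θ)) μ :=
    (integrable_mul_conj hX hY).sub hmY
  have hright : Integrable (fun θ => (X θ - m) * (starRingEnd ℂ) m') μ :=
    ((hX.integrable one_le_two).sub (integrable_const m)).mul_const _
  simp only [hexpand]
  rw [integral_sub hleft hright, integral_sub (integrable_mul_conj hX hY) hmY, hcentre, sub_zero,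
    integral_const_mul, integral_conj]

lemma integral_norm_sum_sq_le {ι : Type*} {s : Finset ι} (a : ι → ℂ) {u : ι → α → ℂ}
    (hu : ∀ n ∈ s, MemLp (u n) 2 μ) :
    ∫ θ, ‖∑ n ∈ s, a n * u n θ‖ ^ 2 ∂μ ≤ ∑ n ∈ s, ∑ k ∈ s,
      ‖a n‖ * ‖a k‖ * ‖∫ θ, u n θ * (starRingEnd ℂ) (u k θ) ∂μ‖ := by
  have hinteg : ∀ n ∈ s, ∀ k ∈ s, Integrable
      (fun θ => a n * (starRingEnd ℂ) (a k) * (u n θ * (starRingEnd ℂ) (u k θ))) μ :=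
    fun n hn k hk => (integrable_mul_conj (hu n hn) (hu k hk)).const_mul _
  have hexpand : ∀ θ, ((‖∑ n ∈ s, a n * u n θ‖ ^ 2 : ℝ) : ℂ) = ∑ n ∈ s, ∑ k ∈ s,
      a n * (starRingEnd ℂ) (a k) * (u n θ * (starRingEnd ℂ) (u k θ)) := fun θ => by
    rw [Complex.ofReal_pow, ← Complex.mul_conj', map_sum, Finset.sum_mul_sum]
    refine Finset.sum_congr rfl fun n _ => Finset.sum_congr rfl fun k _ => ?_
    rw [map_mul]
    ring
  have hmoment : ((∫ θ, ‖∑ n ∈ s, a n * u n θ‖ ^ 2 ∂μ : ℝ) : ℂ) = ∑ n ∈ s, ∑ k ∈ s,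
      a n * (starRingEnd ℂ) (a k) * ∫ θ, u n θ * (starRingEnd ℂ) (u k θ) ∂μ := by
    rw [← integral_complex_ofReal]
    simp only [hexpand]
    rw [integral_finsetSum _ fun n hn => integrable_finsetSum _ (hinteg n hn)]
    refine Finset.sum_congr rfl fun n hn => ?_
    rw [integral_finsetSum _ (hinteg n hn)]
    simp only [integral_const_mul]
  refine (le_abs_self _).trans ?_
  rw [← Real.norm_eq_abs, ← Complex.norm_real, hmoment]
  refine (norm_sum_le _ _).trans (Finset.sum_le_sum fun n _ => (norm_sum_le _ _).trans_eq
    (Finset.sum_congr rfl fun k _ => ?_))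
  rw [norm_mul, norm_mul, RCLike.norm_conj]

lemma integral_norm_sum_sq_le_of_norm_integral_mul_conj_le {s : Finset ℕ} {c : ℝ} (hc0 : 0 ≤ c)
    (hc1 : c < 1) {u : ℕ → α → ℂ} (hu : ∀ n, MemLp (u n) 2 μ) {d : ℕ → ℝ}
    (hcov : ∀ n k, ‖∫ θ, u n θ * (starRingEnd ℂ) (u k θ) ∂μ‖ ≤ c ^ n.dist k * (d n * d k))
    (a : ℕ → ℂ) :
    ∫ θ, ‖∑ n ∈ s, a n * u n θ‖ ^ 2 ∂μ ≤ 2 / (1 - c) * ∑ n ∈ s, ‖a n‖ ^ 2 * d n ^ 2 :=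
  calc ∫ θ, ‖∑ n ∈ s, a n * u n θ‖ ^ 2 ∂μ
      ≤ ∑ n ∈ s, ∑ k ∈ s, ‖a n‖ * ‖a k‖ * ‖∫ θ, u n θ * (starRingEnd ℂ) (u k θ) ∂μ‖ :=
        integral_norm_sum_sq_le a fun n _ => hu n
    _ ≤ ∑ n ∈ s, ∑ k ∈ s, ‖a n‖ * ‖a k‖ * (c ^ n.dist k * (d n * d k)) := by
        gcongr
        exact hcov _ _
    _ = ∑ n ∈ s, ∑ k ∈ s, c ^ n.dist k * ((‖a n‖ * d n) * (‖a k‖ * d k)) := by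
        refine Finset.sum_congr rfl fun n _ => Finset.sum_congr rfl fun k _ => ?_
        ring
    _ ≤ 2 / (1 - c) * ∑ n ∈ s, (‖a n‖ * d n) ^ 2 :=
        sum_sum_mul_le_of_sum_le (fun _ _ => pow_nonneg hc0 _)
          (fun _ _ => by rw [Nat.dist_comm]) (sum_pow_dist_le hc0 hc1 s) _
    _ = 2 / (1 - c) * ∑ n ∈ s, ‖a n‖ ^ 2 * d n ^ 2 := by simp only [mul_pow]

end SecondMoment

section Decorrelation

variable {f : ℂ → ℂ} {z : ℂ}

/-- The boundary function of `f^[n]`, centred at its mean `f^[n] z` with respect to the harmonic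
measure seen from `z`. -/
noncomputable def iterateFluctuation (f : ℂ → ℂ) (z : ℂ) (n : ℕ) (θ : ℝ) : ℂ :=
  boundaryValue (f^[n]) θ - f^[n] z

namespace IsInnerFunction

lemma memLp_iterateFluctuation (hf : IsInnerFunction f) (hz : z ∈ 𝔻) (n : ℕ) :
    MemLp (iterateFluctuation f z n) 2 (discHarmonicMeasure z) := by
  have := isProbabilityMeasure_discHarmonicMeasure hz
  exact ((hf.iterate n).isBoundedAnalytic.memLp_boundaryValue hz 2).sub (memLp_const _)

lemma ae_boundaryValue_iterate_add_mul_conj (hf : IsInnerFunction f) (hf0 : f 0 = 0) (j k : ℕ) :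
    ∀ᵐ θ : ℝ, boundaryValue (f^[j + k]) θ * (starRingEnd ℂ) (boundaryValue (f^[k]) θ) =
      boundaryValue (iterateQuotient f j ∘ f^[k]) θ := by
  have hfk := hf.iterate k
  have hq := (isBoundedAnalytic_iterateQuotient hf.differentiableOn hf.mapsTo j).comp
    hfk.differentiableOn hfk.mapsTo
  have hfactor : f^[j + k] = fun w => f^[k] w * (iterateQuotient f j ∘ f^[k]) w := by
    funext w
    rw [Function.iterate_add_apply, iterate_eq_mul_iterateQuotient hf0, Function.comp_apply]
  filter_upwards [hfk.isBoundedAnalytic.ae_boundaryValue_mul hq, hfk.ae_norm_boundaryValue]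
    with θ hmul hnorm
  rw [hfactor, hmul, mul_right_comm, Complex.mul_conj', hnorm, Complex.ofReal_one, one_pow, one_mul]

lemma integral_iterateFluctuation_add_mul_conj (hf : IsInnerFunction f) (hf0 : f 0 = 0)
    (hz : z ∈ 𝔻) (j k : ℕ) :
    ∫ θ, iterateFluctuation f z (j + k) θ * (starRingEnd ℂ) (iterateFluctuation f z k θ)
        ∂discHarmonicMeasure z =
      iterateQuotient f j (f^[k] z) * (1 - ‖f^[k] z‖ ^ 2 : ℝ) := by
  have := isProbabilityMeasure_discHarmonicMeasure hz
  have hfb := fun n => (hf.iterate n).isBoundedAnalytic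
  have hq := (isBoundedAnalytic_iterateQuotient hf.differentiableOn hf.mapsTo j).comp
    (hf.iterate k).differentiableOn (hf.iterate k).mapsTo
  have hcov := integral_sub_mul_conj_sub ((hfb (j + k)).memLp_boundaryValue hz 2)
    ((hfb k).memLp_boundaryValue hz 2)
  have hprod := (discHarmonicMeasure_absolutelyContinuous z).ae_le
    (hf.ae_boundaryValue_iterate_add_mul_conj hf0 j k)
  rw [(hfb _).integral_boundaryValue hz, (hfb _).integral_boundaryValue hz,
    integral_congr_ae hprod, hq.integral_boundaryValue hz, Function.comp_apply,
    Function.iterate_add_apply, iterate_eq_mul_iterateQuotient hf0 j, mul_right_comm,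
    Complex.mul_conj'] at hcov
  simp only [iterateFluctuation, Function.iterate_add_apply,
    iterate_eq_mul_iterateQuotient hf0 j (f^[k] z)]
  rw [hcov]
  push_cast
  ring

lemma norm_integral_iterateFluctuation_add_mul_conj_le (hf : IsInnerFunction f) (hf0 : f 0 = 0)
    (hrot : ¬ IsDiscRotation f) (hz : z ∈ 𝔻) (j k : ℕ) :
    ‖∫ θ, iterateFluctuation f z (j + k) θ * (starRingEnd ℂ) (iterateFluctuation f z k θ)
        ∂discHarmonicMeasure z‖ ≤
      correlationRate f ^ j * (√(1 - ‖f^[j + k] z‖ ^ 2) * √(1 - ‖f^[k] z‖ ^ 2)) := by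
  have hw := hf.mapsTo.iterate k hz
  have hnonneg := (one_sub_norm_sq_pos hw).le
  have hquot := norm_iterateQuotient_mul_sqrt_le hf.differentiableOn hf.mapsTo
    (mapsTo_dslope_zero hf.differentiableOn hf.mapsTo hf0 hrot) hf0 j hw
  rw [hf.integral_iterateFluctuation_add_mul_conj hf0 hz, norm_mul, Complex.norm_real,
    Real.norm_of_nonneg hnonneg, Function.iterate_add_apply]
  calc ‖iterateQuotient f j (f^[k] z)‖ * (1 - ‖f^[k] z‖ ^ 2)
      = ‖iterateQuotient f j (f^[k] z)‖ * √(1 - ‖f^[k] z‖ ^ 2) * √(1 - ‖f^[k] z‖ ^ 2) := by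
        rw [mul_assoc, Real.mul_self_sqrt hnonneg]
    _ ≤ correlationRate f ^ j * √(1 - ‖f^[j] (f^[k] z)‖ ^ 2) * √(1 - ‖f^[k] z‖ ^ 2) := by gcongr
    _ = _ := mul_assoc _ _ _

theorem norm_integral_iterateFluctuation_mul_conj_le (hf : IsInnerFunction f) (hf0 : f 0 = 0)
    (hrot : ¬ IsDiscRotation f) (hz : z ∈ 𝔻) (n k : ℕ) :
    ‖∫ θ, iterateFluctuation f z n θ * (starRingEnd ℂ) (iterateFluctuation f z k θ)
        ∂discHarmonicMeasure z‖ ≤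
      correlationRate f ^ n.dist k * (√(1 - ‖f^[n] z‖ ^ 2) * √(1 - ‖f^[k] z‖ ^ 2)) := by
  rcases le_total k n with hkn | hnk
  · have hbound := hf.norm_integral_iterateFluctuation_add_mul_conj_le hf0 hrot hz (n - k) k
    rwa [Nat.sub_add_cancel hkn, ← Nat.dist_eq_sub_of_le_right hkn] at hbound
  · have hbound := hf.norm_integral_iterateFluctuation_add_mul_conj_le hf0 hrot hz (k - n) n
    rw [Nat.sub_add_cancel hnk, ← Nat.dist_eq_sub_of_le hnk, mul_comm √(1 - ‖f^[k] z‖ ^ 2),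
      ← RCLike.norm_conj, ← integral_conj] at hbound
    simpa only [map_mul, Complex.conj_conj, mul_comm] using hbound

theorem integral_norm_sum_iterateFluctuation_sq_le (hf : IsInnerFunction f) (hf0 : f 0 = 0)
    (hrot : ¬ IsDiscRotation f) (hz : z ∈ 𝔻) (s : Finset ℕ) (a : ℕ → ℂ) :
    ∫ θ, ‖∑ n ∈ s, a n * iterateFluctuation f z n θ‖ ^ 2 ∂discHarmonicMeasure z ≤
      2 / (1 - correlationRate f) * ∑ n ∈ s, ‖a n‖ ^ 2 * (1 - ‖f^[n] z‖ ^ 2) := by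
  have hslope := mapsTo_dslope_zero hf.differentiableOn hf.mapsTo hf0 hrot
  have hschur := integral_norm_sum_sq_le_of_norm_integral_mul_conj_le (s := s)
    (correlationRate_nonneg f) (correlationRate_lt_one hslope) (hf.memLp_iterateFluctuation hz)
    (hf.norm_integral_iterateFluctuation_mul_conj_le hf0 hrot hz) a
  simpa only [Real.sq_sqrt (one_sub_norm_sq_pos (hf.mapsTo.iterate _ hz)).le] using hschur

end IsInnerFunction

lemma oscillationIntegrand_eq_smul (f : ℂ → ℂ) (N : ℕ) (a : ℕ → ℂ) (z : ℂ) :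
    oscillationIntegrand f N a z = fun ξ => poissonKernel 0 z ξ •
      ‖∑ n ∈ Finset.Icc 1 N, a n * (radialLimit (f^[n]) ξ - f^[n] z)‖ ^ 2 :=
  funext fun _ => mul_comm _ _

lemma IsInnerFunction.circleIntegrable_oscillationIntegrand (hf : IsInnerFunction f) (hz : z ∈ 𝔻)
    (N : ℕ) (a : ℕ → ℂ) : CircleIntegrable (oscillationIntegrand f N a z) 0 1 := by
  rw [oscillationIntegrand_eq_smul, ← integrable_discHarmonicMeasure_iff hz]
  exact (memLp_finsetSum _ fun n _ => (hf.memLp_iterateFluctuation hz n).const_mul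
    (a n)).integrable_norm_pow two_ne_zero

lemma circleAverage_oscillationIntegrand (hz : z ∈ 𝔻) (N : ℕ) (a : ℕ → ℂ) :
    Real.circleAverage (oscillationIntegrand f N a z) 0 1 =
      ∫ θ, ‖∑ n ∈ Finset.Icc 1 N, a n * iterateFluctuation f z n θ‖ ^ 2
        ∂discHarmonicMeasure z := by
  rw [oscillationIntegrand_eq_smul, ← integral_discHarmonicMeasure hz]
  rfl

end Decorrelation

theorem theorem1p2 (f : ℂ → ℂ) (hf : IsInnerFunction f) (hf0 : f 0 = 0)
    (hrot : ¬ IsDiscRotation f) :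
    (∀ n : ℕ, 1 ≤ n → IsInnerFunction (f^[n])) ∧
    ∃ C : ℝ, 0 < C ∧ ∀ N : ℕ, 1 ≤ N → ∀ a : ℕ → ℂ, ∀ z ∈ Metric.ball (0 : ℂ) 1,
      CircleIntegrable (oscillationIntegrand f N a z) 0 1 ∧
      Real.circleAverage (oscillationIntegrand f N a z) 0 1 ≤
        C * ∑ n ∈ Finset.Icc 1 N, ‖a n‖ ^ 2 * (1 - ‖f^[n] z‖ ^ 2) := by
  have hslope := mapsTo_dslope_zero hf.differentiableOn hf.mapsTo hf0 hrot
  have hrate : 0 < 1 - correlationRate f := sub_pos.2 (correlationRate_lt_one hslope)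
  refine ⟨fun n _ => hf.iterate n, 2 / (1 - correlationRate f), by positivity,
    fun N _ a z hz => ⟨hf.circleIntegrable_oscillationIntegrand hz N a, ?_⟩⟩
  rw [circleAverage_oscillationIntegrand hz]
  exact hf.integral_norm_sum_iterateFluctuation_sq_le hf0 hrot hz _ a
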